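/- Let $L>0$ and let $\bar\rho,\bar\theta,R,c_v,\kappa>0$, $\mu>0$ and $\lambda$ with $\lambda+\mu\ge 0$ be real constants. For $T>0$ and $g,h\in L^2(0,T;L^2(0,L))$ consider the system \begin{align*} &\rho_t+\bar\rho\,u_x=0 &&\text{in }(0,L)\times(0,T),\\ &u_t-\frac{\lambda+2\mu}{\bar\rho}u_{xx}+\frac{R\bar\theta}{\bar\rho}\rho_x+R\theta_x=g &&\text{in }(0,L)\times(0,T),\\ &\theta_t-\frac{\kappa}{\bar\rho c_v}\theta_{xx}+\frac{R\bar\theta}{c_v}u_x=h &&\text{in }(0,L)\times(0,T),\\ &u(0,t)=u(L,t)=\theta(0,t)=\theta(L,t)=0, &&t\in(0,T),\\ &\rho(0)=\rho_0,\quad u(0)=u_0,\quad \theta(0)=\theta_0 &&\text{in }(0,L). \end{align*} A solution is a triple $(\rho,u,\theta)\in C([0,T];L^2(0,L)^3)$ with $u,\theta\in L^2(0,T;H^1_0(0,L))$ that satisfies, for all $t\in[0,T]$, the equations integrated over $(0,t)$ with the given initial values: the first one in $L^2(0,L)$, the other two tested against every $\varphi\in H^1_0(0,L)$, where $-u_{xx}$,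 $-\theta_{xx}$ and $\rho_x$ are paired with $\varphi$ as $\int_0^L u_x\varphi_x\,dx$, $\int_0^L\theta_x\varphi_x\,dx$ and $-\int_0^L\rho\,\varphi_x\,dx$. Let $H^1_m(0,L)=\{\rho\in H^1(0,L):\int_0^L\rho\,dx=0\}$ and let $(\rho_0,u_0,\theta_0)\in H^1_m(0,L)\times L^2(0,L)\times L^2(0,L)$. Then for every $T>0$ there exist controls $g,h\in L^2(0,T;L^2(0,L))$ such that the system has a unique solution $(\rho,u,\theta)$, and this solution satisfies $(\rho,u,\theta)(\cdot,T)=(0,0,0)$ in $L^2(0,L)^3$. -/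

import Mathlib

open scoped ContDiff

namespace LinNS

open MeasureTheory Set

noncomputable section

/-- The real Hilbert space `L²(0,L)`. -/
abbrev L2 (L : ℝ) : Type := Lp ℝ 2 (volume.restrict (Ioo (0 : ℝ) L))

/-- `g ∈ L²(0,T; L²(0,L))` (Bochner sense). -/
def MemL2L2 (L T : ℝ) (g : ℝ → L2 L) : Prop :=
  MemLp g 2 (volume.restrict (Ioo (0 : ℝ) T))

/-- `φ ∈ C_c^∞(0,L)`. -/
def IsTestFun (L : ℝ) (φ : ℝ → ℝ) : Prop :=
  ContDiff ℝ ∞ φ ∧ HasCompactSupport φ ∧ tsupport φ ⊆ Ioo 0 L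

/-- `f'` is the weak derivative of `f` on `(0,L)`. -/
def HasWeakDeriv (L : ℝ) (f f' : L2 L) : Prop :=
  ∀ φ : ℝ → ℝ, IsTestFun L φ →
    ∫ x in Ioo 0 L, f x * deriv φ x = -∫ x in Ioo 0 L, f' x * φ x

/-- `H¹_m(0,L)`: the functions of `H¹(0,L)` with zero mean. -/
def H1m (L : ℝ) : Set (L2 L) :=
  {f | (∃ f' : L2 L, HasWeakDeriv L f f') ∧ ∫ x in Ioo 0 L, f x = 0}

/-- The pairs `(φ, φ')` with `φ ∈ C_c^∞(0,L)`, as elements of `L² × L²`. -/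
def testGraph (L : ℝ) : Set (L2 L × L2 L) :=
  {p | ∃ φ : ℝ → ℝ, IsTestFun L φ ∧
    (∀ᵐ x ∂(volume.restrict (Ioo 0 L)), p.1 x = φ x) ∧
    (∀ᵐ x ∂(volume.restrict (Ioo 0 L)), p.2 x = deriv φ x)}

/-- `H¹₀(0,L)`, the closure of `C_c^∞(0,L)` for the `H¹` norm, each element `v` being
listed together with its derivative as the pair `(v, v_x)`. -/
def H10Graph (L : ℝ) : Set (L2 L × L2 L) := closure (testGraph L)

/-- `u ∈ L²(0,T; H¹₀(0,L))`, with space derivative `ux`. -/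
def MemL2H10 (L T : ℝ) (u ux : ℝ → L2 L) : Prop :=
  MemL2L2 L T u ∧ MemL2L2 L T ux ∧
    ∀ᵐ t ∂(volume.restrict (Ioo (0 : ℝ) T)), (u t, ux t) ∈ H10Graph L

/-- The physical constants: the steady state `(ρ̄, 0, θ̄)`, the viscosities `lam`, `mu`, the heat
conductivity `kappa`, the specific heat `cv` and the gas constant `R`. -/
structure Fluid where
  rhoBar : ℝ
  thetaBar : ℝ
  lam : ℝ
  mu : ℝ
  kappa : ℝ
  cv : ℝ
  R : ℝ
  rhoBar_pos : 0 < rhoBar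
  thetaBar_pos : 0 < thetaBar
  mu_pos : 0 < mu
  lam_add_mu_nonneg : 0 ≤ lam + mu
  kappa_pos : 0 < kappa
  cv_pos : 0 < cv
  R_pos : 0 < R

/-- `(ρ, u, θ)` is a (weak) solution on `(0,L) × (0,T)` of

* `ρ_t + ρ̄ u_x = f`,
* `u_t - ((λ+2μ)/ρ̄) u_xx + (R θ̄/ρ̄) ρ_x + R θ_x = g`,
* `θ_t - (κ/(ρ̄ c_v)) θ_xx + (R θ̄/c_v) u_x = h`,

with `u = θ = 0` at `x = 0, L` and initial values `ρ₀, u₀, θ₀`: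
`ρ, u, θ ∈ C([0,T]; L²(0,L))`, `u, θ ∈ L²(0,T; H¹₀(0,L))`, and the equations, integrated from
time `0` to `t`, hold for all `t ∈ [0,T]`: the first in `L²(0,L)`, the other two tested against
every `φ ∈ H¹₀(0,L)`. -/
def IsSolution (F : Fluid) (L T : ℝ) (ρ₀ u₀ θ₀ : L2 L) (f g h : ℝ → L2 L)
    (ρ u θ : ℝ → L2 L) : Prop :=
  ContinuousOn ρ (Icc 0 T) ∧ ContinuousOn u (Icc 0 T) ∧ ContinuousOn θ (Icc 0 T) ∧
  ∃ ux θx : ℝ → L2 L, MemL2H10 L T u ux ∧ MemL2H10 L T θ θx ∧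
    ∀ t ∈ Icc 0 T,
      (ρ t - ρ₀ + F.rhoBar • ∫ s in (0 : ℝ)..t, ux s) = ∫ s in (0 : ℝ)..t, f s ∧
      ∀ φ φx : L2 L, (φ, φx) ∈ H10Graph L →
        (inner ℝ (u t) φ - inner ℝ u₀ φ
          + (F.lam + 2 * F.mu) / F.rhoBar * (∫ s in (0 : ℝ)..t, inner ℝ (ux s) φx)
          - F.R * F.thetaBar / F.rhoBar * (∫ s in (0 : ℝ)..t, inner ℝ (ρ s) φx)
          + F.R * (∫ s in (0 : ℝ)..t, inner ℝ (θx s) φ)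
          = ∫ s in (0 : ℝ)..t, inner ℝ (g s) φ) ∧
        (inner ℝ (θ t) φ - inner ℝ θ₀ φ
          + F.kappa / (F.rhoBar * F.cv) * (∫ s in (0 : ℝ)..t, inner ℝ (θx s) φx)
          + F.R * F.thetaBar / F.cv * (∫ s in (0 : ℝ)..t, inner ℝ (ux s) φ)
          = ∫ s in (0 : ℝ)..t, inner ℝ (h s) φ)

end

end LinNS

/-!
Since the controls act in the whole interval, `g` and `h` can be read off from any prescribed `u`
and `θ`, as long as `ρ_x` stays in `L²(0,T; L²(0,L))`; as `ρ(t) = ρ₀ - ρ̄ ∫₀ᵗ u_x`, this holds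
whenever `u` solves a heat equation with an `L²` source and `ρ₀ ∈ H¹`. The free heat flow,
multiplied by `1 - t/T`, is such a function, with the required initial value and vanishing at time
`T`. Adding `η(t) Q(x)` with `η(0) = η(T) = 0` and `∫₀ᵀ η = 1` changes `∫₀ᵀ u` by any given
`Q ∈ H¹₀`, so that `ρ̄ ∫₀ᵀ u_x = ρ₀` can be attained; this is possible because `ρ₀` has mean zero.

Uniqueness is an energy estimate for the time primitives of the difference of two solutions.
-/

namespace LinNS

open MeasureTheory Set Filter Topology

noncomputable section

/-! ### Integration in time -/

section TimeIntegral

variable {E : Type*} [NormedAddCommGroup E] {T : ℝ} {f : ℝ → E}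

theorem intervalIntegrable_of_memLp_two (hf : MemLp f 2 (volume.restrict (Ioo 0 T))) {t : ℝ}
    (ht : t ∈ Icc 0 T) : IntervalIntegrable f volume 0 t := by
  rw [intervalIntegrable_iff_integrableOn_Ioo_of_le ht.1]
  exact IntegrableOn.mono_set (hf.integrable (by norm_num)) (Ioo_subset_Ioo_right ht.2)

theorem memLp_two_of_continuousOn_Icc (hf : ContinuousOn f (Icc 0 T)) :
    MemLp f 2 (volume.restrict (Ioo 0 T)) := by
  obtain ⟨C, hC⟩ := isCompact_Icc.exists_bound_of_continuousOn hf
  refine MemLp.of_bound ((hf.mono Ioo_subset_Icc_self).aestronglyMeasurable measurableSet_Ioo) C ?_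
  filter_upwards [ae_restrict_mem measurableSet_Ioo] with x hx
  exact hC x (Ioo_subset_Icc_self hx)

variable [NormedSpace ℝ E]

theorem memLp_two_continuous_smul {η : ℝ → ℝ} (hη : Continuous η)
    (hf : MemLp f 2 (volume.restrict (Ioo 0 T))) :
    MemLp (fun t => η t • f t) 2 (volume.restrict (Ioo 0 T)) := by
  obtain ⟨C, hC⟩ := isCompact_Icc.exists_bound_of_continuousOn (hη.continuousOn (s := Icc 0 T))
  refine hf.of_le_mul (c := C) (hη.aestronglyMeasurable.smul hf.1) ?_
  filter_upwards [ae_restrict_mem measurableSet_Ioo] with t ht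
  rw [norm_smul]
  gcongr
  exact hC t (Ioo_subset_Icc_self ht)

theorem continuousOn_primitive_of_memLp_two (hT : 0 ≤ T)
    (hf : MemLp f 2 (volume.restrict (Ioo 0 T))) :
    ContinuousOn (fun t => ∫ s in (0 : ℝ)..t, f s) (Icc 0 T) := by
  rw [← uIcc_of_le hT]
  refine intervalIntegral.continuousOn_primitive_interval ?_
  rw [uIcc_of_le hT, integrableOn_Icc_iff_integrableOn_Ioo]
  exact hf.integrable (by norm_num)

variable [CompleteSpace E]

theorem hasDerivWithinAt_primitive (hf : ContinuousOn f (Icc 0 T)) {t : ℝ} (ht : t ∈ Ico 0 T) :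
    HasDerivWithinAt (fun t => ∫ s in (0 : ℝ)..t, f s) (f t) (Ici t) t := by
  have hnear : Icc 0 T ∈ 𝓝[>] t :=
    mem_of_superset (Ioo_mem_nhdsGT ht.2) fun s hs => ⟨ht.1.trans hs.1.le, hs.2.le⟩
  exact intervalIntegral.integral_hasDerivWithinAt_right (t := Ioi t)
    (intervalIntegrable_of_memLp_two (memLp_two_of_continuousOn_Icc hf) (Ico_subset_Icc_self ht))
    ⟨_, hnear, hf.aestronglyMeasurable measurableSet_Icc⟩
    ((hf t (Ico_subset_Icc_self ht)).mono_of_mem_nhdsWithin hnear)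

theorem eqOn_zero_of_primitive_eq_zero (hT : 0 < T) (hf : ContinuousOn f (Icc 0 T))
    (h : ∀ t ∈ Icc 0 T, ∫ s in (0 : ℝ)..t, f s = 0) : EqOn f 0 (Icc 0 T) := by
  have hIco : EqOn f 0 (Ico 0 T) := fun t ht =>
    (uniqueDiffWithinAt_Ici t).eq_deriv _ (hasDerivWithinAt_primitive hf ht) <|
      (hasDerivWithinAt_const t _ (0 : E)).congr_of_eventuallyEq_of_mem
        (mem_of_superset (Ico_mem_nhdsGE ht.2)
          fun s hs => h s ⟨ht.1.trans hs.1, hs.2.le⟩) self_mem_Ici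
  exact hIco.of_subset_closure hf continuousOn_const Ico_subset_Icc_self
    (by rw [closure_Ico hT.ne])

theorem intervalIntegral_pair_mem {F : Type*} [NormedAddCommGroup F] [NormedSpace ℝ F]
    [CompleteSpace F] {V : Submodule ℝ (E × F)} (hV : IsClosed (V : Set (E × F))) {g : ℝ → F}
    (hf : MemLp f 2 (volume.restrict (Ioo 0 T))) (hg : MemLp g 2 (volume.restrict (Ioo 0 T)))
    (hmem : ∀ᵐ t ∂volume.restrict (Ioo 0 T), (f t, g t) ∈ V) {t : ℝ} (ht : t ∈ Icc 0 T) :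
    (∫ s in (0 : ℝ)..t, f s, ∫ s in (0 : ℝ)..t, g s) ∈ V := by
  rcases ht.1.eq_or_lt with rfl | h0
  · simpa only [intervalIntegral.integral_same] using! V.zero_mem
  have hsub : Ioo 0 t ⊆ Ioo 0 T := Ioo_subset_Ioo_right ht.2
  have hfi : IntegrableOn f (Ioo 0 t) := IntegrableOn.mono_set (hf.integrable (by norm_num)) hsub
  have hgi : IntegrableOn g (Ioo 0 t) := IntegrableOn.mono_set (hg.integrable (by norm_num)) hsub
  have hav := V.convex.set_average_mem hV (by simp [h0]) (by simp)
    (ae_restrict_of_ae_restrict_of_subset hsub hmem) (hfi.prodMk hgi)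
  have hint := V.smul_mem (volume.real (Ioo 0 t)) hav
  rw [measure_smul_setAverage _ (by simp), integral_pair hfi hgi] at hint
  simpa only [intervalIntegral.integral_of_le ht.1, integral_Ioc_eq_integral_Ioo] using hint

end TimeIntegral

theorem inner_intervalIntegral_left {H : Type*} [NormedAddCommGroup H] [InnerProductSpace ℝ H]
    [CompleteSpace H] {a b : ℝ} {f : ℝ → H} (hf : IntervalIntegrable f volume a b) (φ : H) :
    inner ℝ (∫ s in a..b, f s) φ = ∫ s in a..b, inner ℝ (f s) φ := by
  simpa only [innerSL_apply_apply, real_inner_comm φ] using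
    ((innerSL ℝ φ).intervalIntegral_comp_comm hf).symm

theorem intervalIntegrable_inner_const {H : Type*} [NormedAddCommGroup H]
    [InnerProductSpace ℝ H] {a b : ℝ} {f : ℝ → H} (hf : IntervalIntegrable f volume a b) (φ : H) :
    IntervalIntegrable (fun s => inner ℝ (f s) φ) volume a b :=
  ⟨hf.1.inner_const φ, hf.2.inner_const φ⟩

theorem mul_sub_mul_eq_integral_of_eq_primitive {η η' a b : ℝ → ℝ} {c t : ℝ} (ht : 0 ≤ t)
    (hη : ∀ s, HasDerivAt η (η' s) s) (hη' : Continuous η')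
    (hb : IntervalIntegrable b volume 0 t)
    (ha : ∀ s ∈ Icc 0 t, a s = c + ∫ r in (0 : ℝ)..s, b r) :
    η t * a t - η 0 * c = ∫ s in (0 : ℝ)..t, (η s * b s + η' s * a s) := by
  have hderiv : deriv η = η' := funext fun s => (hη s).deriv
  have hηac : AbsolutelyContinuousOnInterval η 0 t :=
    (contDiff_one_iff_deriv.2 ⟨fun s => (hη s).differentiableAt, hderiv ▸ hη'⟩).contDiffOn
      |>.absolutelyContinuousOnInterval
  have hcac : AbsolutelyContinuousOnInterval (fun _ : ℝ => c) 0 t :=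
    contDiff_const.contDiffOn.absolutelyContinuousOnInterval
  have hparts := hηac.integral_deriv_mul_eq_sub
    (hcac.add (hb.absolutelyContinuousOnInterval_intervalIntegral left_mem_uIcc))
  simp only [Pi.add_apply, intervalIntegral.integral_same, add_zero] at hparts
  rw [ha t (right_mem_Icc.2 ht), ← hparts]
  refine intervalIntegral.integral_congr_ae ?_
  filter_upwards [hb.ae_hasDerivAt_integral] with s hs hmem
  have hderiv_a := (hasDerivAt_const s c).add (hs (uIoc_subset_uIcc hmem) 0 left_mem_uIcc)
  rw [uIoc_of_le ht] at hmem
  rw [hderiv, hderiv_a.deriv, ha s (Ioc_subset_Icc_self hmem)]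
  ring

/-! ### Weak solutions of the heat equation -/

section WeakFlow

variable {H K : Type*} [NormedAddCommGroup H] [InnerProductSpace ℝ H]
  [NormedAddCommGroup K] [InnerProductSpace ℝ K]

/-- `p'` is the derivative of `p` in the sense of duality with `V`, the graph of a derivative
`φ ↦ φ_x`. For `V = H¹₀(0,L)` this is the weak derivative. -/
def HasDualDeriv (V : Submodule ℝ (H × K)) (p : K) (p' : H) : Prop :=
  ∀ ⦃φ : H⦄ ⦃φx : K⦄, (φ, φx) ∈ V → inner ℝ p φx = -inner ℝ p' φ

/-- `w` is a weak solution on `[0,T]` of `w_t = ν w_xx + G`, `w(0) = w₀`, where the pairs in `V`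
are the admissible test functions `φ` together with their derivatives `φ_x`. As for `IsSolution`,
the derivative `wx` of `w` is carried along, and the equation is integrated in time. -/
structure IsWeakFlow (V : Submodule ℝ (H × K)) (ν T : ℝ) (w₀ : H) (G w : ℝ → H) (wx : ℝ → K) :
    Prop where
  continuousOn : ContinuousOn w (Icc 0 T)
  memLp_deriv : MemLp wx 2 (volume.restrict (Ioo 0 T))
  memLp_source : MemLp G 2 (volume.restrict (Ioo 0 T))
  ae_mem : ∀ᵐ t ∂volume.restrict (Ioo 0 T), (w t, wx t) ∈ V
  weak_eq : ∀ t ∈ Icc 0 T, ∀ φ φx, (φ, φx) ∈ V →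
    inner ℝ (w t) φ - inner ℝ w₀ φ + ν * inner ℝ (∫ s in (0 : ℝ)..t, wx s) φx
      = inner ℝ (∫ s in (0 : ℝ)..t, G s) φ

variable {V : Submodule ℝ (H × K)} {ν T : ℝ}

theorem HasDualDeriv.add {p q : K} {p' q' : H} (hp : HasDualDeriv V p p')
    (hq : HasDualDeriv V q q') : HasDualDeriv V (p + q) (p' + q') := fun φ φx hφ => by
  rw [inner_add_left, inner_add_left, hp hφ, hq hφ, neg_add]

theorem HasDualDeriv.sub {p q : K} {p' q' : H} (hp : HasDualDeriv V p p')
    (hq : HasDualDeriv V q q') : HasDualDeriv V (p - q) (p' - q') := fun φ φx hφ => by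
  rw [inner_sub_left, inner_sub_left, hp hφ, hq hφ]
  ring

theorem HasDualDeriv.const_smul {p : K} {p' : H} (hp : HasDualDeriv V p p') (c : ℝ) :
    HasDualDeriv V (c • p) (c • p') := fun φ φx hφ => by
  rw [real_inner_smul_left, real_inner_smul_left, hp hφ, mul_neg]

namespace IsWeakFlow

variable {w₀ v₀ : H} {G w F v : ℝ → H} {wx vx : ℝ → K}

theorem memLp (hw : IsWeakFlow V ν T w₀ G w wx) : MemLp w 2 (volume.restrict (Ioo 0 T)) :=
  memLp_two_of_continuousOn_Icc hw.continuousOn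

theorem hasDualDeriv_integral (hν : ν ≠ 0) (hw : IsWeakFlow V ν T w₀ G w wx) {t : ℝ}
    (ht : t ∈ Icc 0 T) :
    HasDualDeriv V (∫ s in (0 : ℝ)..t, wx s)
      (ν⁻¹ • (w t - w₀ - ∫ s in (0 : ℝ)..t, G s)) := fun φ φx hφ => by
  rw [real_inner_smul_left, inner_sub_left, inner_sub_left, ← hw.weak_eq t ht φ φx hφ]
  field_simp
  ring

theorem exists_hasDualDeriv_sub_integral (hT : 0 ≤ T) (hν : ν ≠ 0)
    (hw : IsWeakFlow V ν T w₀ G w wx) {p : K} {p' : H} (hp : HasDualDeriv V p p') (c : ℝ) :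
    ∃ r, MemLp r 2 (volume.restrict (Ioo 0 T)) ∧
      ∀ t ∈ Icc 0 T, HasDualDeriv V (p - c • ∫ s in (0 : ℝ)..t, wx s) (r t) := by
  refine ⟨fun t => p' - c • ν⁻¹ • (w t - w₀ - ∫ s in (0 : ℝ)..t, G s), ?_,
    fun t ht => hp.sub ((hw.hasDualDeriv_integral hν ht).const_smul c)⟩
  have hwc := hw.continuousOn
  have hGc := continuousOn_primitive_of_memLp_two hT hw.memLp_source
  exact memLp_two_of_continuousOn_Icc (by fun_prop)

theorem add (hw : IsWeakFlow V ν T w₀ G w wx) (hv : IsWeakFlow V ν T v₀ F v vx) :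
    IsWeakFlow V ν T (w₀ + v₀) (G + F) (w + v) (wx + vx) where
  continuousOn := hw.continuousOn.add hv.continuousOn
  memLp_deriv := hw.memLp_deriv.add hv.memLp_deriv
  memLp_source := hw.memLp_source.add hv.memLp_source
  ae_mem := by
    filter_upwards [hw.ae_mem, hv.ae_mem] with t hwt hvt using V.add_mem hwt hvt
  weak_eq t ht φ φx hφ := by
    simp only [Pi.add_apply]
    rw [intervalIntegral.integral_add (intervalIntegrable_of_memLp_two hw.memLp_deriv ht)
        (intervalIntegrable_of_memLp_two hv.memLp_deriv ht),
      intervalIntegral.integral_add (intervalIntegrable_of_memLp_two hw.memLp_source ht)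
        (intervalIntegrable_of_memLp_two hv.memLp_source ht)]
    simp only [inner_add_left, ← hw.weak_eq t ht φ φx hφ, ← hv.weak_eq t ht φ φx hφ]
    ring

variable [CompleteSpace H] [CompleteSpace K]

theorem const {P : H} {p : K} {p' : H} (hP : (P, p) ∈ V) (hp : HasDualDeriv V p p') :
    IsWeakFlow V ν T P (fun _ => -(ν • p')) (fun _ => P) (fun _ => p) where
  continuousOn := continuousOn_const
  memLp_deriv := memLp_const p
  memLp_source := memLp_const _
  ae_mem := ae_of_all _ fun _ => hP
  weak_eq t _ φ φx hφ := by
    simp only [intervalIntegral.integral_const, sub_zero, real_inner_smul_left, hp hφ,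
      inner_neg_left]
    ring

theorem inner_weak_eq (hw : IsWeakFlow V ν T w₀ G w wx) {φ : H} {φx : K} (hφ : (φ, φx) ∈ V)
    {t : ℝ} (ht : t ∈ Icc 0 T) :
    inner ℝ (w t) φ
      = inner ℝ w₀ φ + ∫ s in (0 : ℝ)..t, (inner ℝ (G s) φ - ν * inner ℝ (wx s) φx) := by
  have hG := intervalIntegrable_of_memLp_two hw.memLp_source ht
  have hx := intervalIntegrable_of_memLp_two hw.memLp_deriv ht
  rw [intervalIntegral.integral_sub (intervalIntegrable_inner_const hG φ)
      ((intervalIntegrable_inner_const hx φx).const_mul ν),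
    intervalIntegral.integral_const_mul, ← inner_intervalIntegral_left hG,
    ← inner_intervalIntegral_left hx, ← hw.weak_eq t ht φ φx hφ]
  ring

theorem smul (hw : IsWeakFlow V ν T w₀ G w wx) {η η' : ℝ → ℝ}
    (hη : ∀ t, HasDerivAt η (η' t) t) (hη' : Continuous η') :
    IsWeakFlow V ν T (η 0 • w₀) (fun t => η t • G t + η' t • w t)
      (fun t => η t • w t) (fun t => η t • wx t) := by
  have hηc : Continuous η := continuous_iff_continuousAt.2 fun t => (hη t).continuousAt
  have hGη := memLp_two_continuous_smul hηc hw.memLp_source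
  have hwη := memLp_two_continuous_smul hη' hw.memLp
  have hxη := memLp_two_continuous_smul hηc hw.memLp_deriv
  refine ⟨hηc.continuousOn.smul hw.continuousOn, hxη, hGη.add hwη, ?_, fun t ht φ φx hφ => ?_⟩
  · filter_upwards [hw.ae_mem] with t hwt using V.smul_mem (η t) hwt
  · have hG := intervalIntegrable_of_memLp_two hw.memLp_source ht
    have hx := intervalIntegrable_of_memLp_two hw.memLp_deriv ht
    have hGw : IntervalIntegrable (fun s => η s • G s + η' s • w s) volume 0 t :=
      intervalIntegrable_of_memLp_two (hGη.add hwη) ht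
    have hxη := intervalIntegrable_of_memLp_two hxη ht
    have hparts := mul_sub_mul_eq_integral_of_eq_primitive ht.1 hη hη'
      ((intervalIntegrable_inner_const hG φ).sub
        ((intervalIntegrable_inner_const hx φx).const_mul ν))
      (fun s hs => hw.inner_weak_eq hφ (Icc_subset_Icc_right ht.2 hs))
    rw [inner_intervalIntegral_left hGw, inner_intervalIntegral_left hxη,
      ← intervalIntegral.integral_const_mul, ← eq_sub_iff_add_eq,
      ← intervalIntegral.integral_sub (intervalIntegrable_inner_const hGw φ)
        ((intervalIntegrable_inner_const hxη φx).const_mul ν),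
      real_inner_smul_left, real_inner_smul_left, hparts]
    refine intervalIntegral.integral_congr fun s _ => ?_
    simp only [inner_add_left, real_inner_smul_left]
    ring

end IsWeakFlow

/-- The witness is the damped flow plus `η • Q` with `η = 6 s (T - s) / T ^ 3`, of integral `1`
and zero at both ends. -/
theorem exists_isWeakFlow_integral_eq [CompleteSpace H] [CompleteSpace K]
    (hV : IsClosed (V : Set (H × K))) (hν : ν ≠ 0) (hT : 0 < T) {w₀ : H}
    {G w : ℝ → H} {wx : ℝ → K} (hw : IsWeakFlow V ν T w₀ G w wx) (hwT : w T = 0)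
    {P p' : H} {p : K} (hP : (P, p) ∈ V) (hp : HasDualDeriv V p p') :
    ∃ F v vx, IsWeakFlow V ν T w₀ F v vx ∧ v T = 0 ∧ ∫ s in (0 : ℝ)..T, vx s = p := by
  have hTmem : T ∈ Icc 0 T := right_mem_Icc.2 hT.le
  set Q := P - ∫ s in (0 : ℝ)..T, w s
  set q := p - ∫ s in (0 : ℝ)..T, wx s with hq
  have hQ : (Q, q) ∈ V :=
    V.sub_mem hP (intervalIntegral_pair_mem hV hw.memLp hw.memLp_deriv hw.ae_mem hTmem)
  have hqd := hp.sub (hw.hasDualDeriv_integral hν hTmem)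
  have hη : ∀ s : ℝ, HasDerivAt (fun s : ℝ => 6 * s * (T - s) / T ^ 3)
      (6 * (T - 2 * s) / T ^ 3) s := fun s => by
    refine ((((hasDerivAt_id s).const_mul 6).mul
      ((hasDerivAt_id s).const_sub T)).div_const _).congr_deriv ?_
    simp only [id]
    ring
  have hη_int : ∫ s in (0 : ℝ)..T, 6 * s * (T - s) / T ^ 3 = 1 := by
    have hprim : ∀ s ∈ uIcc 0 T, HasDerivAt (fun s : ℝ => (3 * T * s ^ 2 - 2 * s ^ 3) / T ^ 3)
        (6 * s * (T - s) / T ^ 3) s := fun s _ => by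
      refine ((((hasDerivAt_pow 2 s).const_mul (3 * T)).sub
        ((hasDerivAt_pow 3 s).const_mul 2)).div_const _).congr_deriv ?_
      push_cast
      ring
    rw [intervalIntegral.integral_eq_sub_of_hasDerivAt hprim
      (Continuous.intervalIntegrable (by fun_prop) _ _)]
    field_simp
    ring
  have hv := hw.add ((IsWeakFlow.const (ν := ν) (T := T) hQ hqd).smul hη (by fun_prop))
  refine ⟨_, _, _, by simpa using hv, ?_, ?_⟩
  · simp [hwT]
  · simp only [Pi.add_apply]
    rw [intervalIntegral.integral_add (intervalIntegrable_of_memLp_two hw.memLp_deriv hTmem)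
      (Continuous.intervalIntegrable (by fun_prop) _ _), intervalIntegral.integral_smul_const,
      hη_int, one_smul, hq, add_sub_cancel]

end WeakFlow

/-! ### Null controllability of the heat equation -/

theorem exists_mem_topologicalClosure_of_fst_le {E F : Type*} [NormedAddCommGroup E]
    [NormedSpace ℝ E] [CompleteSpace E] [NormedAddCommGroup F] [NormedSpace ℝ F] [CompleteSpace F]
    {W : Submodule ℝ (E × F)} {C : ℝ} (hC : ∀ p ∈ W, ‖p.1‖ ≤ C * ‖p.2‖) {y : F}
    (hy : y ∈ closure (Prod.snd '' (W : Set (E × F)))) : ∃ x, (x, y) ∈ W.topologicalClosure := by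
  have hC' : ∀ p ∈ W.topologicalClosure, ‖p.1‖ ≤ C * ‖p.2‖ := fun p hp =>
    closure_minimal hC (isClosed_le continuous_fst.norm (continuous_snd.norm.const_mul C)) hp
  have hanti : AntilipschitzWith (Real.toNNReal (max C 1))
      ((ContinuousLinearMap.snd ℝ E F).comp W.topologicalClosure.subtypeL) := by
    refine ContinuousLinearMap.antilipschitz_of_bound _ fun p => ?_
    rw [Real.coe_toNNReal _ (by positivity)]
    refine max_le ?_ (le_mul_of_one_le_left (norm_nonneg _) (le_max_right _ _))
    exact (hC' p p.2).trans (mul_le_mul_of_nonneg_right (le_max_left _ _) (norm_nonneg _))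
  have hclosed := hanti.isClosed_range (ContinuousLinearMap.uniformContinuous _)
  have hsub : Prod.snd '' (W : Set (E × F)) ⊆
      range ((ContinuousLinearMap.snd ℝ E F).comp W.topologicalClosure.subtypeL) := by
    rintro _ ⟨p, hp, rfl⟩
    exact ⟨⟨p, W.le_topologicalClosure hp⟩, rfl⟩
  obtain ⟨⟨⟨x, _⟩, hx⟩, rfl⟩ := closure_minimal hsub hclosed hy
  exact ⟨x, hx⟩

/-- The class in `L²(0,a; E)` of a continuous function. -/
def toL2 (E : Type*) [NormedAddCommGroup E] [NormedSpace ℝ E] (a : ℝ) :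
    C(ℝ, E) →ₗ[ℝ] Lp E 2 (volume.restrict (Ioo 0 a)) where
  toFun f := (memLp_two_of_continuousOn_Icc f.continuous.continuousOn).toLp f
  map_add' _ _ := rfl
  map_smul' _ _ := rfl

theorem coeFn_toL2 {E : Type*} [NormedAddCommGroup E] [NormedSpace ℝ E] (a : ℝ) (f : C(ℝ, E)) :
    toL2 E a f =ᵐ[volume.restrict (Ioo 0 a)] f :=
  MemLp.coeFn_toLp (memLp_two_of_continuousOn_Icc f.continuous.continuousOn)

section HeatFlow

variable {H K : Type*} [NormedAddCommGroup H] [InnerProductSpace ℝ H]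
  [NormedAddCommGroup K] [InnerProductSpace ℝ K]

/-- The classical solutions of `w_t = ν w_xx`, each listed together with its derivative `w_x`. -/
def classicalFlow (V : Submodule ℝ (H × K)) (ν : ℝ) : Submodule ℝ (C(ℝ, H) × C(ℝ, K)) where
  carrier := {p | ∀ t, (p.1 t, p.2 t) ∈ V ∧
    ∃ w', HasDerivAt p.1 w' t ∧ HasDualDeriv V (ν • p.2 t) w'}
  zero_mem' t := ⟨V.zero_mem, 0, hasDerivAt_const t 0, fun φ φx _ => by simp⟩
  add_mem' {p q} hp hq t := by
    obtain ⟨hpV, p', hp', hpd⟩ := hp t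
    obtain ⟨hqV, q', hq', hqd⟩ := hq t
    refine ⟨V.add_mem hpV hqV, p' + q', hp'.add hq', ?_⟩
    simpa only [Prod.snd_add, ContinuousMap.add_apply, smul_add] using hpd.add hqd
  smul_mem' c p hp t := by
    obtain ⟨hpV, p', hp', hpd⟩ := hp t
    refine ⟨V.smul_mem c hpV, c • p', hp'.const_smul c, ?_⟩
    simpa only [Prod.smul_snd, ContinuousMap.smul_apply, smul_comm ν c] using hpd.const_smul c

variable {V : Submodule ℝ (H × K)} {ν T : ℝ} {p : C(ℝ, H) × C(ℝ, K)}

theorem norm_sq_add_integral_of_mem_classicalFlow (hp : p ∈ classicalFlow V ν) (t : ℝ) :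
    ‖p.1 t‖ ^ 2 + 2 * ν * ∫ s in (0 : ℝ)..t, ‖p.2 s‖ ^ 2 = ‖p.1 0‖ ^ 2 := by
  have hderiv : ∀ s ∈ uIcc 0 t,
      HasDerivAt (fun s => ‖p.1 s‖ ^ 2) (-(2 * ν) * ‖p.2 s‖ ^ 2) s := fun s _ => by
    obtain ⟨hV, w', hw', hd⟩ := hp s
    have hdissip := hd hV
    rw [real_inner_smul_left, real_inner_self_eq_norm_sq, real_inner_comm] at hdissip
    refine hw'.norm_sq.congr_deriv ?_
    linarith
  have hftc := intervalIntegral.integral_eq_sub_of_hasDerivAt hderiv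
    (Continuous.intervalIntegrable (by fun_prop) _ _)
  rw [intervalIntegral.integral_const_mul] at hftc
  linarith

theorem intervalIntegral_toL2 (f : C(ℝ, K)) {t : ℝ} (ht : t ∈ Icc 0 T) :
    ∫ s in (0 : ℝ)..t, toL2 K T f s = ∫ s in (0 : ℝ)..t, f s := by
  simp only [intervalIntegral.integral_of_le ht.1, integral_Ioc_eq_integral_Ioo]
  exact integral_congr_ae
    (ae_restrict_of_ae_restrict_of_subset (Ioo_subset_Ioo_right ht.2) (coeFn_toL2 T f))

theorem isWeakFlow_of_mem_classicalFlow [CompleteSpace K] (hp : p ∈ classicalFlow V ν) :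
    IsWeakFlow V ν T (p.1 0) 0 p.1 (toL2 K T p.2) where
  continuousOn := p.1.continuous.continuousOn
  memLp_deriv := Lp.memLp _
  memLp_source := MemLp.zero
  ae_mem := by
    filter_upwards [coeFn_toL2 T p.2] with t ht using ht ▸ (hp t).1
  weak_eq t ht φ φx hφ := by
    have hderiv : ∀ s ∈ uIcc 0 t, HasDerivAt (fun s => inner ℝ (p.1 s) φ)
        (-(ν * inner ℝ (p.2 s) φx)) s := fun s _ => by
      obtain ⟨-, w', hw', hd⟩ := hp s
      refine (hw'.inner ℝ (hasDerivAt_const s φ)).congr_deriv ?_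
      rw [inner_zero_right, zero_add, ← real_inner_smul_left, hd hφ, neg_neg]
    have hftc := intervalIntegral.integral_eq_sub_of_hasDerivAt hderiv
      (Continuous.intervalIntegrable (by fun_prop) _ _)
    rw [intervalIntegral_toL2 p.2 ht,
      inner_intervalIntegral_left (p.2.continuous.intervalIntegrable _ _), ← hftc,
      intervalIntegral.integral_neg, intervalIntegral.integral_const_mul]
    simp

/-- The eigenvector `e` decays at the rate `exp (-ν lam t)`. -/
theorem exists_mem_classicalFlow_of_eigenvector {e : H} {d : K} {lam : ℝ} (he : (e, d) ∈ V)
    (hd : HasDualDeriv V d (-(lam • e))) : ∃ p ∈ classicalFlow V ν, p.1 0 = e := by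
  let decay (t : ℝ) : ℝ := Real.exp (-(ν * lam) * t)
  refine ⟨(⟨fun t => decay t • e, by fun_prop⟩, ⟨fun t => decay t • d, by fun_prop⟩),
    fun t => ⟨V.smul_mem _ he, (decay t * -(ν * lam)) • e, ?_, ?_⟩, by simp [decay]⟩
  · simpa [decay] using! (((hasDerivAt_id t).const_mul (-(ν * lam))).exp).smul_const e
  · convert! (hd.const_smul (decay t)).const_smul ν using 1
    module

/-- The trace on `[0,T]` of a curve, in the norm controlled by the energy identity. The initial
value is listed separately. -/
def energyTrace (T : ℝ) : C(ℝ, H) × C(ℝ, K) →ₗ[ℝ]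
    (C(Icc 0 T, H) × Lp K 2 (volume.restrict (Ioo 0 T))) × H where
  toFun p := ((p.1.restrict (Icc 0 T), toL2 K T p.2), p.1 0)
  map_add' _ _ := by simp only [map_add, Prod.fst_add, Prod.snd_add]; rfl
  map_smul' _ _ := by simp only [map_smul, Prod.smul_fst, Prod.smul_snd]; rfl

theorem norm_toL2_sq (hT : 0 ≤ T) (f : C(ℝ, K)) :
    ‖toL2 K T f‖ ^ 2 = ∫ s in (0 : ℝ)..T, ‖f s‖ ^ 2 := by
  rw [← real_inner_self_eq_norm_sq, L2.inner_def, intervalIntegral.integral_of_le hT,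
    integral_Ioc_eq_integral_Ioo]
  refine integral_congr_ae ?_
  filter_upwards [coeFn_toL2 T f] with s hs
  rw [hs, real_inner_self_eq_norm_sq]

theorem norm_energyTrace_fst_le (hT : 0 ≤ T) (hν : 0 < ν) (hp : p ∈ classicalFlow V ν) :
    ‖(energyTrace T p).1‖ ≤ max 1 (√(2 * ν))⁻¹ * ‖(energyTrace T p).2‖ := by
  have hint_nonneg (t : ℝ) (ht : 0 ≤ t) : 0 ≤ ∫ s in (0 : ℝ)..t, ‖p.2 s‖ ^ 2 :=
    intervalIntegral.integral_nonneg ht fun s _ => by positivity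
  refine max_le ?_ ?_
  · refine (ContinuousMap.norm_le _ (by positivity)).2 fun t => ?_
    calc ‖p.1 t‖ ≤ ‖p.1 0‖ := by
          refine le_of_sq_le_sq ?_ (norm_nonneg _)
          nlinarith [norm_sq_add_integral_of_mem_classicalFlow hp t, hint_nonneg t t.2.1]
      _ ≤ _ := le_mul_of_one_le_left (norm_nonneg _) (le_max_left _ _)
  · calc ‖toL2 K T p.2‖ ≤ (√(2 * ν))⁻¹ * ‖p.1 0‖ := by
          rw [← div_eq_inv_mul, le_div_iff₀' (by positivity)]
          refine le_of_sq_le_sq ?_ (norm_nonneg _)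
          rw [mul_pow, Real.sq_sqrt (by positivity), norm_toL2_sq hT]
          nlinarith [norm_sq_add_integral_of_mem_classicalFlow hp T]
      _ ≤ _ := mul_le_mul_of_nonneg_right (le_max_right _ _) (norm_nonneg _)

theorem inner_intervalIntegral_eq_inner_indicatorConstLp [CompleteSpace K] {t : ℝ}
    (ht : t ∈ Icc 0 T) (φ : K) (g : Lp K 2 (volume.restrict (Ioo 0 T))) :
    inner ℝ (∫ s in (0 : ℝ)..t, g s) φ = inner ℝ
      (indicatorConstLp 2 (measurableSet_Ioo (a := 0) (b := t)) (measure_ne_top _ _) φ) g := by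
  rw [L2.inner_indicatorConstLp_eq_inner_setIntegral, Measure.restrict_restrict measurableSet_Ioo,
    inter_eq_left.2 (Ioo_subset_Ioo_right ht.2), real_inner_comm,
    intervalIntegral.integral_of_le ht.1, integral_Ioc_eq_integral_Ioo]

theorem continuous_inner_intervalIntegral [CompleteSpace K] {t : ℝ} (ht : t ∈ Icc 0 T) (φ : K) :
    Continuous fun g : Lp K 2 (volume.restrict (Ioo 0 T)) =>
      inner ℝ (∫ s in (0 : ℝ)..t, g s) φ := by
  simp only [inner_intervalIntegral_eq_inner_indicatorConstLp ht]
  fun_prop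

theorem ae_mem_of_tendsto {α E F : Type*} [MeasurableSpace α] {μ : Measure α}
    [TopologicalSpace E] [NormedAddCommGroup F] {S : Set (E × F)} (hS : IsClosed S)
    {f : ℕ → α → E} {f₀ : α → E} (hf : ∀ᵐ t ∂μ, Tendsto (f · t) atTop (𝓝 (f₀ t)))
    {g : ℕ → Lp F 2 μ} {g₀ : Lp F 2 μ} (hg : Tendsto g atTop (𝓝 g₀))
    (hmem : ∀ n, ∀ᵐ t ∂μ, (f n t, g n t) ∈ S) : ∀ᵐ t ∂μ, (f₀ t, g₀ t) ∈ S := by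
  obtain ⟨k, hk, hgk⟩ := (tendstoInMeasure_of_tendsto_Lp hg).exists_seq_tendsto_ae
  filter_upwards [hf, hgk, ae_all_iff.2 hmem] with t hft hgt ht
  exact hS.mem_of_tendsto ((hft.comp hk.tendsto_atTop).prodMk_nhds hgt)
    (Eventually.of_forall fun n => ht (k n))

theorem exists_isWeakFlow_of_mem_closure [CompleteSpace H] [CompleteSpace K]
    (hV : IsClosed (V : Set (H × K))) (hν : 0 < ν) (hT : 0 ≤ T) {w₀ : H}
    (hw₀ : w₀ ∈ closure ((fun p : C(ℝ, H) × C(ℝ, K) => p.1 0) '' classicalFlow V ν)) :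
    ∃ w wx, IsWeakFlow V ν T w₀ 0 w wx := by
  obtain ⟨⟨w, wx⟩, hmem⟩ := exists_mem_topologicalClosure_of_fst_le
    (W := (classicalFlow V ν).map (energyTrace T)) (y := w₀)
    (by rintro _ ⟨p, hp, rfl⟩; exact norm_energyTrace_fst_le hT hν hp)
    (by simpa only [Submodule.map_coe, image_image] using! hw₀)
  obtain ⟨q, hq, hlim⟩ := mem_closure_iff_seq_limit.1 hmem
  choose p hp hpq using hq
  obtain rfl : q = fun n => energyTrace T (p n) := funext fun n => (hpq n).symm
  have hlim₀ : Tendsto (fun n => (p n).1 0) atTop (𝓝 w₀) := hlim.snd_nhds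
  have hlim_w (t : Icc 0 T) : Tendsto (fun n => (p n).1 t) atTop (𝓝 (w t)) :=
    ((continuous_eval_const t).tendsto w).comp hlim.fst_nhds.fst_nhds
  have hlim_wx : Tendsto (fun n => toL2 K T (p n).2) atTop (𝓝 wx) := hlim.fst_nhds.snd_nhds
  have hflow (n : ℕ) := isWeakFlow_of_mem_classicalFlow (T := T) (hp n)
  have hae_Icc : ∀ᵐ t ∂volume.restrict (Ioo 0 T), t ∈ Icc 0 T :=
    (ae_restrict_mem measurableSet_Ioo).mono fun t ht => Ioo_subset_Icc_self ht
  refine ⟨IccExtend hT w, wx, w.continuous.Icc_extend'.continuousOn, Lp.memLp wx, MemLp.zero,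
    ?_, fun t ht φ φx hφ => ?_⟩
  · refine ae_mem_of_tendsto hV (f := fun n => (p n).1) ?_ hlim_wx fun n => (hflow n).ae_mem
    filter_upwards [hae_Icc] with t ht
    simpa only [IccExtend_of_mem hT w ht] using hlim_w ⟨t, ht⟩
  · rw [IccExtend_of_mem hT w ht]
    have hlim_eq := (((hlim_w ⟨t, ht⟩).inner (tendsto_const_nhds (x := φ))).sub
      (hlim₀.inner (tendsto_const_nhds (x := φ)))).add
      ((((continuous_inner_intervalIntegral ht φx).tendsto wx).comp hlim_wx).const_mul ν)
    exact tendsto_nhds_unique hlim_eq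
      (tendsto_const_nhds.congr fun n => ((hflow n).weak_eq t ht φ φx hφ).symm)

/-- The heat semigroup acts on all of `H` once the Dirichlet eigenvectors `-e_xx = lam e` span a
dense subspace. Multiplying by `1 - t / T` brings it to rest at time `T`. -/
theorem exists_isWeakFlow_eq_zero [CompleteSpace H] [CompleteSpace K]
    (hV : IsClosed (V : Set (H × K)))
    (hdense : Dense (Submodule.span ℝ
      {e : H | ∃ d lam, (e, d) ∈ V ∧ HasDualDeriv V d (-((lam : ℝ) • e))} : Set H))
    (hν : 0 < ν) (hT : 0 < T) (w₀ : H) :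
    ∃ G w wx, IsWeakFlow V ν T w₀ G w wx ∧ w T = 0 := by
  have hspan : Submodule.span ℝ
      {e : H | ∃ d lam, (e, d) ∈ V ∧ HasDualDeriv V d (-((lam : ℝ) • e))} ≤
      (classicalFlow V ν).map
        ((ContinuousMap.evalCLM ℝ (0 : ℝ)).toLinearMap.comp (LinearMap.fst ℝ _ _)) := by
    refine Submodule.span_le.2 ?_
    rintro e ⟨d, lam, he, hd⟩
    exact exists_mem_classicalFlow_of_eigenvector he hd
  obtain ⟨w, wx, hw⟩ := exists_isWeakFlow_of_mem_closure hV hν hT.le (T := T)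
    (closure_mono hspan (hdense w₀))
  have hdamp (t : ℝ) : HasDerivAt (fun t => 1 - t / T) (-(1 / T)) t :=
    ((hasDerivAt_id t).div_const T).const_sub 1
  exact ⟨_, _, _, by simpa using hw.smul hdamp continuous_const, by simp [hT.ne']⟩

end HeatFlow

/-! ### The energy estimate -/

theorem eqOn_zero_of_hasDerivWithinAt_le_mul {E E' : ℝ → ℝ} {K T : ℝ}
    (hE : ContinuousOn E (Icc 0 T)) (hE' : ∀ t ∈ Ico 0 T, HasDerivWithinAt E (E' t) (Ici t) t)
    (hle : ∀ t ∈ Ico 0 T, E' t ≤ K * E t) (h0 : E 0 = 0) (hnonneg : ∀ t, 0 ≤ E t) :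
    EqOn E 0 (Icc 0 T) := fun t ht => by
  have hgronwall := le_gronwallBound_of_liminf_deriv_right_le (δ := 0) (ε := 0) hE
    (fun s hs r hr => (hE' s hs).liminf_right_slope_le hr) h0.le
    (fun s hs => (hle s hs).trans_eq (add_zero _).symm) t ht
  rw [gronwallBound_ε0_δ0] at hgronwall
  exact hgronwall.antisymm (hnonneg t)

section Uniqueness

variable {H : Type*} [NormedAddCommGroup H] [InnerProductSpace ℝ H]

theorem neg_mul_inner_le {κ : ℝ} (hκ : 0 < κ) (R : ℝ) (y z : H) :
    -(R * inner ℝ y z) ≤ κ * ‖y‖ ^ 2 + R ^ 2 / (4 * κ) * ‖z‖ ^ 2 := by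
  have hsq : κ * ‖y + (R / (2 * κ)) • z‖ ^ 2
      = κ * ‖y‖ ^ 2 + R * inner ℝ y z + R ^ 2 / (4 * κ) * ‖z‖ ^ 2 := by
    rw [norm_add_sq_real, norm_smul, real_inner_smul_right, mul_pow, Real.norm_eq_abs, sq_abs]
    field_simp
    ring
  have hnonneg : 0 ≤ κ * ‖y + (R / (2 * κ)) • z‖ ^ 2 := by positivity
  linarith

/-- The terms `ν ‖X‖²` and `κ ‖Y‖²` of the tested equations absorb the coupling. -/
theorem energy_rate_le {ν α κ : ℝ} (hν : 0 < ν) (hα : 0 < α) (hκ : 0 < κ) (R c : ℝ)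
    {U u W X Θ θ Y : H}
    (hu : inner ℝ u U + ν * inner ℝ X X + α * inner ℝ W X + R * inner ℝ Y U = 0)
    (hθ : inner ℝ θ Θ + κ * inner ℝ Y Y + c * inner ℝ X Θ = 0) :
    2 * inner ℝ U u + α * (2 * inner ℝ W X) + 2 * inner ℝ Θ θ
      ≤ (R ^ 2 / (2 * κ) + c ^ 2 / (2 * ν)) * (‖U‖ ^ 2 + α * ‖W‖ ^ 2 + ‖Θ‖ ^ 2) := by
  rw [real_inner_self_eq_norm_sq, real_inner_comm] at hu hθ
  have hYU := neg_mul_inner_le hκ R Y U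
  have hXΘ := neg_mul_inner_le hν c X Θ
  calc 2 * inner ℝ U u + α * (2 * inner ℝ W X) + 2 * inner ℝ Θ θ
      ≤ R ^ 2 / (2 * κ) * ‖U‖ ^ 2 + c ^ 2 / (2 * ν) * ‖Θ‖ ^ 2 := by
        have hR : R ^ 2 / (2 * κ) = 2 * (R ^ 2 / (4 * κ)) := by ring
        have hc : c ^ 2 / (2 * ν) = 2 * (c ^ 2 / (4 * ν)) := by ring
        rw [hR, hc]
        linarith
    _ ≤ R ^ 2 / (2 * κ) * (‖U‖ ^ 2 + α * ‖W‖ ^ 2 + ‖Θ‖ ^ 2)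
        + c ^ 2 / (2 * ν) * (‖U‖ ^ 2 + α * ‖W‖ ^ 2 + ‖Θ‖ ^ 2) := by
        gcongr
        · exact le_add_of_le_of_nonneg (le_add_of_nonneg_right (by positivity)) (by positivity)
        · exact le_add_of_nonneg_left (by positivity)
    _ = _ := by ring

/-- Only the time primitives of `u` and `θ` are known to be admissible test functions at every
time, so the energy is that of the primitives. -/
theorem eq_zero_of_homogeneous_system [CompleteSpace H] {V : Submodule ℝ (H × H)}
    (hV : IsClosed (V : Set (H × H))) {T ν α κ R c : ℝ} (hT : 0 < T) (hν : 0 < ν) (hα : 0 < α)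
    (hκ : 0 < κ) {u θ ux θx : ℝ → H}
    (hu : ContinuousOn u (Icc 0 T)) (hux : MemLp ux 2 (volume.restrict (Ioo 0 T)))
    (hθ : ContinuousOn θ (Icc 0 T)) (hθx : MemLp θx 2 (volume.restrict (Ioo 0 T)))
    (humem : ∀ᵐ t ∂volume.restrict (Ioo 0 T), (u t, ux t) ∈ V)
    (hθmem : ∀ᵐ t ∂volume.restrict (Ioo 0 T), (θ t, θx t) ∈ V)
    (hueq : ∀ t ∈ Icc 0 T, ∀ φ φx, (φ, φx) ∈ V →
      inner ℝ (u t) φ + ν * inner ℝ (∫ s in (0 : ℝ)..t, ux s) φx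
        + α * inner ℝ (∫ s in (0 : ℝ)..t, ∫ r in (0 : ℝ)..s, ux r) φx
        + R * inner ℝ (∫ s in (0 : ℝ)..t, θx s) φ = 0)
    (hθeq : ∀ t ∈ Icc 0 T, ∀ φ φx, (φ, φx) ∈ V →
      inner ℝ (θ t) φ + κ * inner ℝ (∫ s in (0 : ℝ)..t, θx s) φx
        + c * inner ℝ (∫ s in (0 : ℝ)..t, ux s) φ = 0) :
    EqOn u 0 (Icc 0 T) ∧ EqOn θ 0 (Icc 0 T) ∧ ∀ t ∈ Icc 0 T, ∫ s in (0 : ℝ)..t, ux s = 0 := by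
  have hu2 := memLp_two_of_continuousOn_Icc hu
  have hθ2 := memLp_two_of_continuousOn_Icc hθ
  have hX := continuousOn_primitive_of_memLp_two hT.le hux
  set U : ℝ → H := fun t => ∫ s in (0 : ℝ)..t, u s with hU
  set X : ℝ → H := fun t => ∫ s in (0 : ℝ)..t, ux s
  set W : ℝ → H := fun t => ∫ s in (0 : ℝ)..t, X s with hW
  set Θ : ℝ → H := fun t => ∫ s in (0 : ℝ)..t, θ s with hΘ
  have hUc : ContinuousOn U (Icc 0 T) := continuousOn_primitive_of_memLp_two hT.le hu2
  have hWc : ContinuousOn W (Icc 0 T) :=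
    continuousOn_primitive_of_memLp_two hT.le (memLp_two_of_continuousOn_Icc hX)
  have hΘc : ContinuousOn Θ (Icc 0 T) := continuousOn_primitive_of_memLp_two hT.le hθ2
  have henergy : EqOn (fun t => ‖U t‖ ^ 2 + α * ‖W t‖ ^ 2 + ‖Θ t‖ ^ 2) 0 (Icc 0 T) := by
    refine eqOn_zero_of_hasDerivWithinAt_le_mul
      (K := R ^ 2 / (2 * κ) + c ^ 2 / (2 * ν)) (by fun_prop)
      (fun t ht => ((hasDerivWithinAt_primitive hu ht).norm_sq.add
        ((hasDerivWithinAt_primitive hX ht).norm_sq.const_mul α)).add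
        (hasDerivWithinAt_primitive hθ ht).norm_sq)
      (fun t ht => ?_) (by simp [hU, hW, hΘ]) (fun t => by positivity)
    have ht' := Ico_subset_Icc_self ht
    exact energy_rate_le hν hα hκ R c
      (hueq t ht' _ _ (intervalIntegral_pair_mem hV hu2 hux humem ht'))
      (hθeq t ht' _ _ (intervalIntegral_pair_mem hV hθ2 hθx hθmem ht'))
  have hzero (t : ℝ) (ht : t ∈ Icc 0 T) : (U t = 0 ∧ W t = 0) ∧ Θ t = 0 := by
    have hsum : ‖U t‖ ^ 2 + α * ‖W t‖ ^ 2 + ‖Θ t‖ ^ 2 = 0 := henergy ht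
    rw [add_eq_zero_iff_of_nonneg (by positivity) (by positivity),
      add_eq_zero_iff_of_nonneg (by positivity) (by positivity)] at hsum
    simpa [hα.ne'] using hsum
  exact ⟨eqOn_zero_of_primitive_eq_zero hT hu fun t ht => (hzero t ht).1.1,
    eqOn_zero_of_primitive_eq_zero hT hθ fun t ht => (hzero t ht).2,
    eqOn_zero_of_primitive_eq_zero hT hX fun t ht => (hzero t ht).1.2⟩

end Uniqueness

/-! ### The space `H¹₀(0,L)` -/

theorem norm_toL2_le {E : Type*} [NormedAddCommGroup E] [NormedSpace ℝ E] {a C : ℝ} (ha : 0 ≤ a)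
    (hC : 0 ≤ C) {f : C(ℝ, E)} (hf : ∀ x ∈ Ioo 0 a, ‖f x‖ ≤ C) : ‖toL2 E a f‖ ≤ √a * C := by
  have hbound := Lp.norm_le_of_ae_bound (f := toL2 E a f) hC <| by
    filter_upwards [coeFn_toL2 a f, ae_restrict_mem measurableSet_Ioo] with x hx hxa
    exact hx ▸ hf x hxa
  simpa [measureUnivNNReal, ENNReal.coe_toNNReal_eq_toReal, ha, Real.sqrt_eq_rpow] using hbound

theorem norm_toL2_le_of_hasDerivAt {a : ℝ} (ha : 0 ≤ a) {f f' : C(ℝ, ℝ)}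
    (hf : ∀ x, HasDerivAt f (f' x) x) (h0 : f 0 = 0) : ‖toL2 ℝ a f‖ ≤ a * ‖toL2 ℝ a f'‖ := by
  have hpointwise : ∀ x ∈ Ioo 0 a, ‖f x‖ ≤ √a * ‖toL2 ℝ a f'‖ := fun x hx => by
    have hxa := Ioo_subset_Icc_self hx
    have hftc := intervalIntegral.integral_eq_sub_of_hasDerivAt (a := 0) (b := x)
      (fun y _ => hf y) (f'.continuous.intervalIntegrable _ _)
    have hmass : (volume.restrict (Ioo 0 a)).real (Ioo 0 x) = x := by
      rw [measureReal_restrict_apply measurableSet_Ioo,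
        inter_eq_left.2 (Ioo_subset_Ioo_right hxa.2), Real.volume_real_Ioo_of_le hxa.1, sub_zero]
    calc ‖f x‖ = |inner ℝ (∫ y in (0 : ℝ)..x, toL2 ℝ a f' y) (1 : ℝ)| := by
          rw [intervalIntegral_toL2 f' hxa, hftc, h0]
          simp
      _ ≤ √x * ‖toL2 ℝ a f'‖ := by
          rw [inner_intervalIntegral_eq_inner_indicatorConstLp hxa]
          refine (abs_real_inner_le_norm _ _).trans_eq ?_
          rw [norm_indicatorConstLp (by simp) (by simp), hmass]
          simp [Real.sqrt_eq_rpow]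
      _ ≤ √a * ‖toL2 ℝ a f'‖ := by gcongr; exact hxa.2
  calc ‖toL2 ℝ a f‖ ≤ √a * (√a * ‖toL2 ℝ a f'‖) := norm_toL2_le ha (by positivity) hpointwise
    _ = a * ‖toL2 ℝ a f'‖ := by rw [← mul_assoc, Real.mul_self_sqrt ha]

section TestFunctions

variable {L : ℝ}

theorem toL2_eq_iff {p : L2 L} {f : C(ℝ, ℝ)} :
    p = toL2 ℝ L f ↔ ∀ᵐ x ∂volume.restrict (Ioo 0 L), p x = f x :=
  ⟨fun h => h ▸ coeFn_toL2 L f, fun h => Lp.ext (EventuallyEq.trans h (coeFn_toL2 L f).symm)⟩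

theorem inner_toL2 (f : C(ℝ, ℝ)) (v : L2 L) :
    inner ℝ (toL2 ℝ L f) v = ∫ x in Ioo 0 L, f x * v x := by
  rw [L2.inner_def]
  refine integral_congr_ae ?_
  filter_upwards [coeFn_toL2 L f] with x hx
  rw [hx, real_inner_eq_re_inner]
  simp [mul_comm]

theorem IsTestFun.add {φ ψ : ℝ → ℝ} (hφ : IsTestFun L φ) (hψ : IsTestFun L ψ) :
    IsTestFun L (φ + ψ) :=
  ⟨hφ.1.add hψ.1, hφ.2.1.add hψ.2.1, (tsupport_add φ ψ).trans (union_subset hφ.2.2 hψ.2.2)⟩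

theorem IsTestFun.const_smul {φ : ℝ → ℝ} (hφ : IsTestFun L φ) (c : ℝ) : IsTestFun L (c • φ) :=
  ⟨hφ.1.const_smul c, hφ.2.1.smul_left (f := fun _ => c),
    (tsupport_smul_subset_right (fun _ => c) φ).trans hφ.2.2⟩

theorem mem_testGraph_iff {p : L2 L × L2 L} :
    p ∈ testGraph L ↔ ∃ φ φ' : C(ℝ, ℝ), IsTestFun L φ ∧ (∀ x, HasDerivAt φ (φ' x) x) ∧
      (toL2 ℝ L φ, toL2 ℝ L φ') = p := by
  constructor
  · rintro ⟨φ, hφ, hp₁, hp₂⟩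
    refine ⟨⟨φ, hφ.1.continuous⟩, ⟨deriv φ, hφ.1.continuous_deriv (by simp)⟩, hφ,
      fun x => (hφ.1.differentiable (by simp) x).hasDerivAt, ?_⟩
    exact Prod.ext (toL2_eq_iff.2 hp₁).symm (toL2_eq_iff.2 hp₂).symm
  · rintro ⟨φ, φ', hφ, hderiv, rfl⟩
    have hφ' : φ' = deriv φ := funext fun x => (hderiv x).deriv.symm
    exact ⟨φ, hφ, coeFn_toL2 L φ, hφ' ▸ coeFn_toL2 L φ'⟩

variable (L) in
/-- The graph of the derivative on `C_c^∞(0,L)`, as a subspace of `L² × L²`. -/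
def testSubmodule : Submodule ℝ (L2 L × L2 L) where
  carrier := testGraph L
  zero_mem' := mem_testGraph_iff.2 ⟨0, 0, ⟨contDiff_const, HasCompactSupport.zero, by simp⟩,
    fun x => hasDerivAt_const x 0, by simp⟩
  add_mem' hp hq := by
    obtain ⟨φ, φ', hφ, hderivφ, rfl⟩ := mem_testGraph_iff.1 hp
    obtain ⟨ψ, ψ', hψ, hderivψ, rfl⟩ := mem_testGraph_iff.1 hq
    exact mem_testGraph_iff.2 ⟨φ + ψ, φ' + ψ', hφ.add hψ,
      fun x => (hderivφ x).add (hderivψ x), by simp⟩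
  smul_mem' c p hp := by
    obtain ⟨φ, φ', hφ, hderiv, rfl⟩ := mem_testGraph_iff.1 hp
    exact mem_testGraph_iff.2 ⟨c • φ, c • φ', hφ.const_smul c,
      fun x => (hderiv x).const_smul c, by simp⟩

variable (L) in
/-- `H10Graph L` as a closed subspace of `L² × L²`. -/
def H10 : Submodule ℝ (L2 L × L2 L) := (testSubmodule L).topologicalClosure

theorem isClosed_H10 : IsClosed (H10 L : Set (L2 L × L2 L)) :=
  Submodule.isClosed_topologicalClosure _

theorem HasWeakDeriv.hasDualDeriv {f f' : L2 L} (hf : HasWeakDeriv L f f') :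
    HasDualDeriv (H10 L) f f' := fun φ φx hφ => by
  have hclosed : IsClosed {p : L2 L × L2 L | inner ℝ f p.2 = -inner ℝ f' p.1} :=
    isClosed_eq (by fun_prop) (by fun_prop)
  refine closure_minimal (fun p hp => ?_) hclosed hφ
  obtain ⟨φ, φ', hφ, hderiv, rfl⟩ := mem_testGraph_iff.1 hp
  have hφ' : φ' = deriv φ := funext fun x => (hderiv x).deriv.symm
  have h := hf φ hφ
  rw [mem_ofPred_eq, real_inner_comm, inner_toL2, real_inner_comm, inner_toL2]
  simpa only [hφ', mul_comm] using h

theorem hasWeakDeriv_toL2 (hL : 0 ≤ L) {f f' : C(ℝ, ℝ)} (hf : ∀ x, HasDerivAt f (f' x) x) :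
    HasWeakDeriv L (toL2 ℝ L f) (toL2 ℝ L f') := fun φ hφ => by
  have hφ0 : φ 0 = 0 := image_eq_zero_of_notMem_tsupport fun h => (hφ.2.2 h).1.false
  have hφL : φ L = 0 := image_eq_zero_of_notMem_tsupport fun h => (hφ.2.2 h).2.false
  have hparts := intervalIntegral.integral_mul_deriv_eq_deriv_mul (a := 0) (b := L)
    (fun x _ => hf x) (fun x _ => (hφ.1.differentiable (by simp) x).hasDerivAt)
    (f'.continuous.intervalIntegrable _ _)
    ((hφ.1.continuous_deriv (by simp)).intervalIntegrable _ _)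
  rw [hφ0, hφL, mul_zero, mul_zero, sub_zero, zero_sub] at hparts
  simp only [intervalIntegral.integral_of_le hL, integral_Ioc_eq_integral_Ioo] at hparts
  convert hparts using 1
  · refine integral_congr_ae ?_
    filter_upwards [coeFn_toL2 L f] with x hx using by rw [hx]
  · congr 1
    refine integral_congr_ae ?_
    filter_upwards [coeFn_toL2 L f'] with x hx using by rw [hx]

theorem dense_toL2_isTestFun :
    Dense {v : L2 L | ∃ φ : C(ℝ, ℝ), IsTestFun L φ ∧ toL2 ℝ L φ = v} := by
  have hsub : ((testSubmodule L).map (LinearMap.fst ℝ _ _) : Set (L2 L)) ⊆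
      {v : L2 L | ∃ φ : C(ℝ, ℝ), IsTestFun L φ ∧ toL2 ℝ L φ = v} := by
    rintro _ ⟨p, hp, rfl⟩
    obtain ⟨φ, φ', hφ, -, rfl⟩ := mem_testGraph_iff.1 hp
    exact ⟨φ, hφ, rfl⟩
  refine Dense.mono hsub ?_
  rw [Submodule.dense_iff_topologicalClosure_eq_top, Submodule.topologicalClosure_eq_top_iff,
    Submodule.eq_bot_iff]
  intro f hf
  have hint : IntegrableOn f (Ioo 0 L) := (Lp.memLp f).integrable (by norm_num)
  refine (Lp.eq_zero_iff_ae_eq_zero).2 <| (ae_restrict_iff' measurableSet_Ioo).2 <|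
    isOpen_Ioo.ae_eq_zero_of_integral_contDiff_smul_eq_zero hint.locallyIntegrableOn
      fun φ hφ hφc hφL => ?_
  have hmem : toL2 ℝ L ⟨φ, hφ.continuous⟩ ∈ (testSubmodule L).map (LinearMap.fst ℝ _ _) :=
    ⟨_, mem_testGraph_iff.2 ⟨⟨φ, hφ.continuous⟩, ⟨deriv φ, hφ.continuous_deriv (by simp)⟩,
      ⟨hφ, hφc, hφL⟩, fun x => (hφ.differentiable (by simp) x).hasDerivAt, rfl⟩, rfl⟩
  have horth := (Submodule.mem_orthogonal _ _).1 hf _ hmem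
  rw [inner_toL2] at horth
  refine Eq.trans (setIntegral_eq_integral_of_forall_compl_eq_zero fun x hx => ?_).symm horth
  rw [image_eq_zero_of_notMem_tsupport fun h => hx (hφL h), zero_smul]

theorem integral_eq_inner_toL2_one (v : L2 L) :
    ∫ x in Ioo 0 L, v x = inner ℝ (toL2 ℝ L 1) v := by
  simp [inner_toL2]

theorem integral_toL2 (hL : 0 ≤ L) (f : C(ℝ, ℝ)) :
    ∫ x in Ioo 0 L, toL2 ℝ L f x = ∫ x in (0 : ℝ)..L, f x := by
  rw [← integral_Ioc_eq_integral_Ioo, ← intervalIntegral.integral_of_le hL,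
    intervalIntegral_toL2 f (right_mem_Icc.2 hL)]

theorem exists_isTestFun_integral_eq_one (hL : 0 < L) :
    ∃ χ : C(ℝ, ℝ), IsTestFun L χ ∧ ∫ x in (0 : ℝ)..L, χ x = 1 := by
  let bump : ContDiffBump (L / 2) := ⟨L / 8, L / 4, by positivity, by linarith⟩
  have hsupp : tsupport (bump.normed volume) ⊆ Ioo 0 L := by
    rw [bump.tsupport_normed_eq, Real.closedBall_eq_Icc]
    exact Icc_subset_Ioo (by simp only [bump]; linarith) (by simp only [bump]; linarith)
  refine ⟨⟨bump.normed volume, bump.continuous_normed⟩,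
    ⟨bump.contDiff_normed, bump.hasCompactSupport_normed, hsupp⟩, ?_⟩
  exact (intervalIntegral.integral_eq_integral_of_support_subset
    ((subset_tsupport _).trans (hsupp.trans Ioo_subset_Ioc_self))).trans bump.integral_normed

theorem tsupport_primitive_subset {ψ : ℝ → ℝ} {a b : ℝ} (hψ : Continuous ψ) (ha : 0 < a)
    (hb : b < L) (hsupp : tsupport ψ ⊆ Icc a b) (hmean : ∫ x in (0 : ℝ)..L, ψ x = 0) :
    tsupport (fun x => ∫ y in (0 : ℝ)..x, ψ y) ⊆ Icc a b := by
  have hzero : ∀ y ∉ Icc a b, ψ y = 0 := fun y hy =>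
    image_eq_zero_of_notMem_tsupport fun h => hy (hsupp h)
  refine closure_minimal (fun x hx => ?_) isClosed_Icc
  by_contra hxab
  refine hx ?_
  rcases lt_or_ge x a with hxa | hax
  · exact intervalIntegral.integral_zero_ae <| ae_of_all _ fun y hy => hzero y fun hyab =>
      ((hy.2.trans_lt (max_lt ha hxa)).not_ge hyab.1)
  · change ∫ y in (0 : ℝ)..x, ψ y = 0
    have hbx : b < x := not_le.1 fun h => hxab ⟨hax, h⟩
    rw [← intervalIntegral.integral_add_adjacent_intervals (hψ.intervalIntegrable 0 L)
      (hψ.intervalIntegrable L x), hmean, zero_add]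
    exact intervalIntegral.integral_zero_ae <| ae_of_all _ fun y hy => hzero y fun hyab =>
      ((lt_min hb hbx).trans hy.1).not_ge hyab.2

theorem IsTestFun.primitive (hL : 0 < L) {ψ : ℝ → ℝ} (hψ : IsTestFun L ψ)
    (hmean : ∫ x in (0 : ℝ)..L, ψ x = 0) : IsTestFun L (fun x => ∫ y in (0 : ℝ)..x, ψ y) := by
  have hKL : insert (L / 2) (tsupport ψ) ⊆ Ioo 0 L :=
    insert_subset ⟨half_pos hL, half_lt_self hL⟩ hψ.2.2
  have hK : IsCompact (insert (L / 2) (tsupport ψ)) := hψ.2.1.isCompact.insert _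
  obtain ⟨a, haK, ha⟩ := hK.exists_isLeast (insert_nonempty _ _)
  obtain ⟨b, hbK, hb⟩ := hK.exists_isGreatest (insert_nonempty _ _)
  have hsupp := tsupport_primitive_subset hψ.1.continuous (hKL haK).1 (hKL hbK).2
    (fun x hx => ⟨ha (mem_insert_of_mem _ hx), hb (mem_insert_of_mem _ hx)⟩) hmean
  have hderiv : deriv (fun x => ∫ y in (0 : ℝ)..x, ψ y) = ψ :=
    funext fun x => hψ.1.continuous.deriv_integral ψ 0 x
  refine ⟨contDiff_infty_iff_deriv.2 ⟨fun x => ?_, by rw [hderiv]; exact hψ.1⟩,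
    isCompact_Icc.of_isClosed_subset (isClosed_tsupport _) hsupp,
    hsupp.trans (Icc_subset_Ioo (hKL haK).1 (hKL hbK).2)⟩
  exact (hψ.1.continuous.integral_hasStrictDerivAt 0 x).hasDerivAt.differentiableAt

theorem exists_mem_testSubmodule_snd_eq (hL : 0 < L) {ψ : C(ℝ, ℝ)} (hψ : IsTestFun L ψ)
    (hmean : ∫ x in (0 : ℝ)..L, ψ x = 0) : ∃ p ∈ testSubmodule L, p.2 = toL2 ℝ L ψ := by
  have hprim := hψ.primitive hL hmean
  exact ⟨_, mem_testGraph_iff.2 ⟨⟨_, hprim.1.continuous⟩, ψ, hprim,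
    fun x => (ψ.continuous.integral_hasStrictDerivAt 0 x).hasDerivAt, rfl⟩, rfl⟩

/-- Subtracting from test functions the multiple of a bump that makes their mean vanish shows that
the derivatives of test functions are dense among the functions of zero mean. -/
theorem exists_mem_H10_of_integral_eq_zero (hL : 0 < L) {w : L2 L}
    (hw : ∫ x in Ioo 0 L, w x = 0) : ∃ v, (v, w) ∈ H10 L := by
  refine exists_mem_topologicalClosure_of_fst_le (C := L) (fun p hp => ?_) ?_
  · obtain ⟨φ, φ', hφ, hderiv, rfl⟩ := mem_testGraph_iff.1 hp
    exact norm_toL2_le_of_hasDerivAt hL.le hderiv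
      (image_eq_zero_of_notMem_tsupport fun h => (hφ.2.2 h).1.false)
  obtain ⟨χ, hχ, hχ_mean⟩ := exists_isTestFun_integral_eq_one hL
  let center (v : L2 L) : L2 L := v - (inner ℝ (toL2 ℝ L 1) v) • toL2 ℝ L χ
  have hcenter_w : center w = w := by
    simp only [center, ← integral_eq_inner_toL2_one, hw, zero_smul, sub_zero]
  rw [← hcenter_w]
  refine map_mem_closure (by fun_prop) (dense_toL2_isTestFun w) ?_
  rintro _ ⟨φ, hφ, rfl⟩
  set m := ∫ x in (0 : ℝ)..L, φ x with hm
  obtain ⟨p, hp, hpw⟩ := exists_mem_testSubmodule_snd_eq hL (ψ := φ + (-m) • χ)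
    (hφ.add (hχ.const_smul (-m))) (by
      simp only [ContinuousMap.add_apply, ContinuousMap.smul_apply, smul_eq_mul]
      rw [intervalIntegral.integral_add (φ.continuous.intervalIntegrable _ _)
        ((χ.continuous.intervalIntegrable _ _).const_mul _), intervalIntegral.integral_const_mul,
        hχ_mean, ← hm]
      ring)
  refine ⟨p, hp, ?_⟩
  rw [hpw, map_add, map_smul, neg_smul, ← sub_eq_add_neg, hm, ← integral_toL2 hL.le,
    integral_eq_inner_toL2_one]

theorem toL2_mem_H10 (hL : 0 < L) {f f' : C(ℝ, ℝ)} (hf : ∀ x, HasDerivAt f (f' x) x)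
    (h0 : f 0 = 0) (hfL : f L = 0) : (toL2 ℝ L f, toL2 ℝ L f') ∈ H10 L := by
  have hmean : ∫ x in Ioo 0 L, toL2 ℝ L f' x = 0 := by
    rw [integral_toL2 hL.le, intervalIntegral.integral_eq_sub_of_hasDerivAt (fun x _ => hf x)
      (f'.continuous.intervalIntegrable _ _), h0, hfL, sub_zero]
  obtain ⟨v, hv⟩ := exists_mem_H10_of_integral_eq_zero hL hmean
  have hclosed : IsClosed {p : L2 L × L2 L | ‖toL2 ℝ L f - p.1‖ ≤ L * ‖toL2 ℝ L f' - p.2‖} :=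
    isClosed_le (by fun_prop) (by fun_prop)
  have hpoincare : testGraph L ⊆
      {p : L2 L × L2 L | ‖toL2 ℝ L f - p.1‖ ≤ L * ‖toL2 ℝ L f' - p.2‖} := fun p hp => by
    obtain ⟨φ, φ', hφ, hderiv, rfl⟩ := mem_testGraph_iff.1 hp
    rw [mem_ofPred_eq, ← map_sub, ← map_sub]
    refine norm_toL2_le_of_hasDerivAt hL.le (fun x => (hf x).sub (hderiv x)) ?_
    rw [ContinuousMap.sub_apply, h0, sub_eq_zero]
    exact (image_eq_zero_of_notMem_tsupport fun h => (hφ.2.2 h).1.false).symm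
  have hdist := closure_minimal hpoincare hclosed hv
  rw [mem_ofPred_eq, sub_self, norm_zero, mul_zero, norm_le_zero_iff, sub_eq_zero] at hdist
  exact hdist ▸ hv

end TestFunctions

/-! ### Density of the sine modes -/

section SineModes

/-- The mode `sin (nπx/L)`, a Dirichlet eigenfunction on `(0,L)`. Negative `n` are allowed so that
the product formula with `cos (πx/L)` has no exceptional case. -/
def sinMode (L : ℝ) (n : ℤ) : C(ℝ, ℝ) := ⟨fun x => Real.sin (n * (Real.pi / L * x)), by fun_prop⟩

/-- The mode `cos (nπx/L)`. -/
def cosMode (L : ℝ) (n : ℤ) : C(ℝ, ℝ) := ⟨fun x => Real.cos (n * (Real.pi / L * x)), by fun_prop⟩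

variable {L : ℝ}

theorem hasDerivAt_sinMode (n : ℤ) (x : ℝ) :
    HasDerivAt (sinMode L n) (((n * (Real.pi / L)) • cosMode L n) x) x := by
  refine ((((hasDerivAt_id x).const_mul (Real.pi / L)).const_mul (n : ℝ)).sin).congr_deriv ?_
  simp only [cosMode, id, ContinuousMap.smul_apply, ContinuousMap.coe_mk, smul_eq_mul]
  ring

theorem hasDerivAt_cosMode (n : ℤ) (x : ℝ) :
    HasDerivAt (cosMode L n) ((-(n * (Real.pi / L)) • sinMode L n) x) x := by
  refine ((((hasDerivAt_id x).const_mul (Real.pi / L)).const_mul (n : ℝ)).cos).congr_deriv ?_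
  simp only [sinMode, id, ContinuousMap.smul_apply, ContinuousMap.coe_mk, smul_eq_mul]
  ring

theorem exists_hasDualDeriv_sinMode (hL : 0 < L) (n : ℤ) :
    ∃ d lam, (toL2 ℝ L (sinMode L n), d) ∈ H10 L ∧
      HasDualDeriv (H10 L) d (-((lam : ℝ) • toL2 ℝ L (sinMode L n))) := by
  refine ⟨_, (n * (Real.pi / L)) * (n * (Real.pi / L)), toL2_mem_H10 hL (hasDerivAt_sinMode n)
    (by simp [sinMode]) ?_, ?_⟩
  · have hnode : sinMode L n L = Real.sin (n * Real.pi) := by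
      simp only [sinMode, ContinuousMap.coe_mk, div_mul_cancel₀ _ hL.ne']
    rw [hnode, Real.sin_int_mul_pi]
  · have hcos := (hasWeakDeriv_toL2 hL.le (hasDerivAt_cosMode (L := L) n)).hasDualDeriv.const_smul
      (n * (Real.pi / L))
    rwa [map_smul, smul_smul, mul_neg, neg_smul, ← map_smul] at hcos

theorem sinMode_mul_cosMode_one (n : ℤ) :
    cosMode L 1 * sinMode L n
      = (1 / 2 : ℝ) • sinMode L (n + 1) + (1 / 2 : ℝ) • sinMode L (n - 1) := by
  ext x
  simp only [sinMode, cosMode, ContinuousMap.mul_apply, ContinuousMap.add_apply,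
    ContinuousMap.smul_apply, ContinuousMap.coe_mk, smul_eq_mul, Int.cast_add, Int.cast_sub,
    Int.cast_one, add_mul, sub_mul, one_mul, Real.sin_add, Real.sin_sub]
  ring

theorem aeval_cosMode_mul_sinMode_mem_span (p : Polynomial ℝ) :
    Polynomial.aeval (cosMode L 1) p * sinMode L 1 ∈ Submodule.span ℝ (range (sinMode L)) := by
  refine Polynomial.aeval_apply_smul_mem_of_le_comap' (Submodule.subset_span (mem_range_self 1)) p
    (cosMode L 1) (Submodule.span_le.2 ?_)
  rintro _ ⟨n, rfl⟩
  change cosMode L 1 * sinMode L n ∈ Submodule.span ℝ (range (sinMode L))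
  rw [sinMode_mul_cosMode_one]
  exact Submodule.add_mem _ (Submodule.smul_mem _ _ (Submodule.subset_span (mem_range_self _)))
    (Submodule.smul_mem _ _ (Submodule.subset_span (mem_range_self _)))

/-- The quotient `φ / sin (πx/L)` is continuous, hence a continuous function of `cos (πx/L)`, to
which Weierstrass' theorem applies. -/
theorem IsTestFun.exists_polynomial_near (hL : 0 < L) {φ : ℝ → ℝ} (hφ : IsTestFun L φ) {ε : ℝ}
    (hε : 0 < ε) : ∃ p : Polynomial ℝ, ∀ x ∈ Icc 0 L,
      |φ x - (Polynomial.aeval (cosMode L 1) p * sinMode L 1) x| ≤ ε := by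
  have hsin_ne : ∀ x ∈ tsupport φ, sinMode L 1 x ≠ 0 := fun x hx => by
    obtain ⟨hx0, hxL⟩ := hφ.2.2 hx
    have hxπ : Real.pi / L * x < Real.pi := by
      rwa [div_mul_eq_mul_div, div_lt_iff₀ hL, mul_lt_mul_iff_right₀ Real.pi_pos]
    simpa [sinMode] using (Real.sin_pos_of_pos_of_lt_pi (by positivity) hxπ).ne'
  have hquot : Continuous fun x => φ x / sinMode L 1 x := by
    refine continuous_of_tsupport fun x hx => ?_
    have hxφ : x ∈ tsupport φ :=
      closure_mono ((Function.support_div _ _).trans_subset inter_subset_left) hx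
    exact hφ.1.continuous.continuousAt.div (sinMode L 1).continuous.continuousAt (hsin_ne x hxφ)
  obtain ⟨p, hp⟩ := exists_polynomial_near_of_continuousOn (-1) 1
    (fun y => φ (Real.arccos y * (L / Real.pi)) / sinMode L 1 (Real.arccos y * (L / Real.pi)))
    (hquot.comp (by fun_prop)).continuousOn ε hε
  refine ⟨p, fun x hx => ?_⟩
  have harccos : Real.arccos (cosMode L 1 x) * (L / Real.pi) = x := by
    have hxπ : Real.pi / L * x ≤ Real.pi := by
      rw [div_mul_eq_mul_div, div_le_iff₀ hL]
      gcongr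
      exact hx.2
    simp only [cosMode, ContinuousMap.coe_mk, Int.cast_one, one_mul]
    rw [Real.arccos_cos (by have := hx.1; positivity) hxπ]
    field_simp
  have hfactor : φ x = φ x / sinMode L 1 x * sinMode L 1 x := by
    by_cases hφx : φ x = 0
    · rw [hφx, zero_div, zero_mul]
    · rw [div_mul_cancel₀ _ (hsin_ne x (subset_tsupport φ hφx))]
  have hnear := hp (cosMode L 1 x) ⟨Real.neg_one_le_cos _, Real.cos_le_one _⟩
  rw [harccos, abs_sub_comm] at hnear
  calc |φ x - (Polynomial.aeval (cosMode L 1) p * sinMode L 1) x|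
      = |φ x / sinMode L 1 x - p.eval (cosMode L 1 x)| * |sinMode L 1 x| := by
        rw [← abs_mul, sub_mul, ← hfactor, ContinuousMap.mul_apply,
          Polynomial.aeval_continuousMap_apply]
    _ ≤ ε * 1 := mul_le_mul hnear.le (Real.abs_sin_le_one _) (abs_nonneg _) hε.le
    _ = ε := mul_one ε

theorem dense_span_sinMode (hL : 0 < L) :
    Dense (Submodule.span ℝ (range fun n => toL2 ℝ L (sinMode L n)) : Set (L2 L)) := by
  refine (dense_toL2_isTestFun.mono ?_).of_closure
  rintro _ ⟨φ, hφ, rfl⟩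
  refine Metric.mem_closure_iff.2 fun ε hε => ?_
  obtain ⟨p, hp⟩ := hφ.exists_polynomial_near hL (ε := ε / (√L + 1)) (by positivity)
  refine ⟨toL2 ℝ L (Polynomial.aeval (cosMode L 1) p * sinMode L 1), ?_, ?_⟩
  · have hmap := Submodule.mem_map_of_mem (f := toL2 ℝ L)
      (aeval_cosMode_mul_sinMode_mem_span (L := L) p)
    rwa [Submodule.map_span, ← range_comp] at hmap
  · rw [dist_eq_norm, ← map_sub]
    have hbound := norm_toL2_le (f := φ - Polynomial.aeval (cosMode L 1) p * sinMode L 1) hL.le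
      (by positivity) fun x hx => hp x (Ioo_subset_Icc_self hx)
    calc _ ≤ √L * (ε / (√L + 1)) := hbound
      _ < ε := by
        rw [← mul_div_assoc, div_lt_iff₀ (by positivity)]
        nlinarith

end SineModes

/-! ### The linearized Navier-Stokes system -/

section Control

theorem Fluid.viscosity_pos (F : Fluid) : 0 < (F.lam + 2 * F.mu) / F.rhoBar :=
  div_pos (by linarith [F.mu_pos, F.lam_add_mu_nonneg]) F.rhoBar_pos

theorem Fluid.conductivity_pos (F : Fluid) : 0 < F.kappa / (F.rhoBar * F.cv) :=
  div_pos F.kappa_pos (mul_pos F.rhoBar_pos F.cv_pos)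

variable {F : Fluid} {L T : ℝ}

/-- The controls are the sources of the decoupled flows plus the coupling terms; they are in `L²`
because `ρ_x` is. -/
theorem exists_isSolution_of_isWeakFlow (hT : 0 ≤ T) {ρ₀ r₀ u₀ θ₀ : L2 L}
    {G u ux K θ θx : ℝ → L2 L} (hρ₀ : HasDualDeriv (H10 L) ρ₀ r₀)
    (hu : IsWeakFlow (H10 L) ((F.lam + 2 * F.mu) / F.rhoBar) T u₀ G u ux)
    (hθ : IsWeakFlow (H10 L) (F.kappa / (F.rhoBar * F.cv)) T θ₀ K θ θx) :
    ∃ g h, MemL2L2 L T g ∧ MemL2L2 L T h ∧ IsSolution F L T ρ₀ u₀ θ₀ (fun _ => 0) g h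
      (fun t => ρ₀ - F.rhoBar • ∫ s in (0 : ℝ)..t, ux s) u θ := by
  obtain ⟨r, hr2, hr⟩ := hu.exists_hasDualDeriv_sub_integral hT F.viscosity_pos.ne' hρ₀ F.rhoBar
  have hX := continuousOn_primitive_of_memLp_two hT hu.memLp_deriv
  refine ⟨G + (F.R * F.thetaBar / F.rhoBar) • r + F.R • θx, K + (F.R * F.thetaBar / F.cv) • ux,
    (hu.memLp_source.add (hr2.const_smul _)).add (hθ.memLp_deriv.const_smul _),
    hθ.memLp_source.add (hu.memLp_deriv.const_smul _),
    by fun_prop, hu.continuousOn, hθ.continuousOn, ux, θx, ⟨hu.memLp, hu.memLp_deriv, hu.ae_mem⟩,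
    ⟨hθ.memLp, hθ.memLp_deriv, hθ.ae_mem⟩, fun t ht => ⟨by simp, fun φ φx hφ => ?_⟩⟩
  have hint {f : ℝ → L2 L} (hf : MemLp f 2 (volume.restrict (Ioo 0 T))) :=
    intervalIntegrable_of_memLp_two hf ht
  have hinner {f : ℝ → L2 L} (hf : MemLp f 2 (volume.restrict (Ioo 0 T))) (ψ : L2 L) :=
    intervalIntegrable_inner_const (hint hf) ψ
  simp only [Pi.add_apply, Pi.smul_apply, inner_add_left, real_inner_smul_left]
  constructor
  · have hρr : ∫ s in (0 : ℝ)..t, inner ℝ (ρ₀ - F.rhoBar • ∫ r in (0 : ℝ)..s, ux r) φx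
        = -∫ s in (0 : ℝ)..t, inner ℝ (r s) φ := by
      rw [← intervalIntegral.integral_neg]
      refine intervalIntegral.integral_congr fun s hs => ?_
      rw [uIcc_of_le ht.1] at hs
      exact hr s (Icc_subset_Icc_right ht.2 hs) hφ
    rw [hρr, intervalIntegral.integral_add
        ((hinner hu.memLp_source φ).add ((hinner hr2 φ).const_mul _))
        ((hinner hθ.memLp_deriv φ).const_mul _),
      intervalIntegral.integral_add (hinner hu.memLp_source φ) ((hinner hr2 φ).const_mul _),
      intervalIntegral.integral_const_mul, intervalIntegral.integral_const_mul,
      ← inner_intervalIntegral_left (hint hu.memLp_deriv),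
      ← inner_intervalIntegral_left (hint hu.memLp_source), ← hu.weak_eq t ht φ φx hφ]
    ring
  · rw [intervalIntegral.integral_add (hinner hθ.memLp_source φ)
        ((hinner hu.memLp_deriv φ).const_mul _), intervalIntegral.integral_const_mul,
      ← inner_intervalIntegral_left (hint hθ.memLp_deriv),
      ← inner_intervalIntegral_left (hint hθ.memLp_source), ← hθ.weak_eq t ht φ φx hφ]

theorem IsSolution.sub {ρ₀ u₀ θ₀ : L2 L} {f g h ρ u θ ρ' u' θ' : ℝ → L2 L}
    (hs : IsSolution F L T ρ₀ u₀ θ₀ f g h ρ u θ) (hs' : IsSolution F L T ρ₀ u₀ θ₀ f g h ρ' u' θ') :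
    IsSolution F L T 0 0 0 0 0 0 (ρ - ρ') (u - u') (θ - θ') := by
  obtain ⟨hρ, hu, hθ, ux, θx, ⟨hu2, hux, humem⟩, ⟨hθ2, hθx, hθmem⟩, heq⟩ := hs
  obtain ⟨hρ', hu', hθ', ux', θx', ⟨hu2', hux', humem'⟩, ⟨hθ2', hθx', hθmem'⟩, heq'⟩ := hs'
  refine ⟨hρ.sub hρ', hu.sub hu', hθ.sub hθ', ux - ux', θx - θx',
    ⟨hu2.sub hu2', hux.sub hux', ?_⟩, ⟨hθ2.sub hθ2', hθx.sub hθx', ?_⟩, fun t ht => ?_⟩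
  · filter_upwards [humem, humem'] with t h h' using (H10 L).sub_mem h h'
  · filter_upwards [hθmem, hθmem'] with t h h' using (H10 L).sub_mem h h'
  have hint_sub {v v' : ℝ → L2 L} (hv : MemLp v 2 (volume.restrict (Ioo 0 T)))
      (hv' : MemLp v' 2 (volume.restrict (Ioo 0 T))) (ψ : L2 L) :
      ∫ s in (0 : ℝ)..t, inner ℝ ((v - v') s) ψ
        = (∫ s in (0 : ℝ)..t, inner ℝ (v s) ψ) - ∫ s in (0 : ℝ)..t, inner ℝ (v' s) ψ := by
    simp only [Pi.sub_apply, inner_sub_left]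
    exact intervalIntegral.integral_sub
      (intervalIntegrable_inner_const (intervalIntegrable_of_memLp_two hv ht) ψ)
      (intervalIntegrable_inner_const (intervalIntegrable_of_memLp_two hv' ht) ψ)
  obtain ⟨hmass, hweak⟩ := heq t ht
  obtain ⟨hmass', hweak'⟩ := heq' t ht
  refine ⟨?_, fun φ φx hφ => ?_⟩
  · simp only [Pi.sub_apply, Pi.zero_apply, intervalIntegral.integral_zero]
    rw [intervalIntegral.integral_sub (intervalIntegrable_of_memLp_two hux ht)
      (intervalIntegrable_of_memLp_two hux' ht)]
    linear_combination (norm := module) hmass - hmass'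
  · rw [hint_sub hux hux', hint_sub hux hux', hint_sub hθx hθx', hint_sub hθx hθx', hint_sub
      (memLp_two_of_continuousOn_Icc hρ) (memLp_two_of_continuousOn_Icc hρ')]
    simp only [Pi.sub_apply, Pi.zero_apply, inner_sub_left, inner_zero_left,
      intervalIntegral.integral_zero]
    exact ⟨by linear_combination (hweak φ φx hφ).1 - (hweak' φ φx hφ).1,
      by linear_combination (hweak φ φx hφ).2 - (hweak' φ φx hφ).2⟩

theorem IsSolution.eqOn_zero (hT : 0 < T) {ρ u θ : ℝ → L2 L}
    (hs : IsSolution F L T 0 0 0 0 0 0 ρ u θ) :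
    EqOn ρ 0 (Icc 0 T) ∧ EqOn u 0 (Icc 0 T) ∧ EqOn θ 0 (Icc 0 T) := by
  obtain ⟨hρ, hu, hθ, ux, θx, ⟨-, hux, humem⟩, ⟨-, hθx, hθmem⟩, heq⟩ := hs
  have hmass : ∀ t ∈ Icc 0 T, ρ t = -(F.rhoBar • ∫ s in (0 : ℝ)..t, ux s) := fun t ht =>
    eq_neg_of_add_eq_zero_left (by simpa using (heq t ht).1)
  have hρint (t : ℝ) (ht : t ∈ Icc 0 T) : ∫ s in (0 : ℝ)..t, ρ s
      = -(F.rhoBar • ∫ s in (0 : ℝ)..t, ∫ r in (0 : ℝ)..s, ux r) := by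
    rw [← intervalIntegral.integral_smul, ← intervalIntegral.integral_neg]
    refine intervalIntegral.integral_congr fun s hs => hmass s ?_
    rw [uIcc_of_le ht.1] at hs
    exact Icc_subset_Icc_right ht.2 hs
  have hint {f : ℝ → L2 L} (hf : MemLp f 2 (volume.restrict (Ioo 0 T))) {t : ℝ}
      (ht : t ∈ Icc 0 T) (ψ : L2 L) :
      ∫ s in (0 : ℝ)..t, inner ℝ (f s) ψ = inner ℝ (∫ s in (0 : ℝ)..t, f s) ψ :=
    (inner_intervalIntegral_left (intervalIntegrable_of_memLp_two hf ht) ψ).symm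
  obtain ⟨hu0, hθ0, hX0⟩ := eq_zero_of_homogeneous_system (R := F.R)
    (c := F.R * F.thetaBar / F.cv) isClosed_H10 hT F.viscosity_pos
    (mul_pos F.R_pos F.thetaBar_pos) F.conductivity_pos hu hux hθ hθx humem hθmem
    (fun t ht φ φx hφ => by
      have hmomentum := ((heq t ht).2 φ φx hφ).1
      rw [hint hux ht, hint hθx ht, hint (memLp_two_of_continuousOn_Icc hρ) ht,
        hρint t ht] at hmomentum
      simp only [inner_neg_left, real_inner_smul_left, inner_zero_left, Pi.zero_apply,
        intervalIntegral.integral_zero, sub_zero] at hmomentum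
      have := F.rhoBar_pos.ne'
      refine Eq.trans ?_ hmomentum
      field_simp
      ring)
    (fun t ht φ φx hφ => by
      have henergy := ((heq t ht).2 φ φx hφ).2
      rw [hint hux ht, hint hθx ht] at henergy
      simpa only [inner_zero_left, Pi.zero_apply, intervalIntegral.integral_zero, sub_zero]
        using henergy)
  exact ⟨fun t ht => by simp [hmass t ht, hX0 t ht], hu0, hθ0⟩

theorem IsSolution.unique (hT : 0 < T) {ρ₀ u₀ θ₀ : L2 L} {f g h ρ u θ ρ' u' θ' : ℝ → L2 L}
    (hs : IsSolution F L T ρ₀ u₀ θ₀ f g h ρ u θ) (hs' : IsSolution F L T ρ₀ u₀ θ₀ f g h ρ' u' θ') :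
    EqOn ρ ρ' (Icc 0 T) ∧ EqOn u u' (Icc 0 T) ∧ EqOn θ θ' (Icc 0 T) := by
  obtain ⟨hρ, hu, hθ⟩ := (hs.sub hs').eqOn_zero hT
  exact ⟨fun t ht => sub_eq_zero.1 (hρ ht), fun t ht => sub_eq_zero.1 (hu ht),
    fun t ht => sub_eq_zero.1 (hθ ht)⟩

theorem exists_isWeakFlow_H10_eq_zero (hL : 0 < L) {ν : ℝ} (hν : 0 < ν) (hT : 0 < T)
    (w₀ : L2 L) : ∃ G w wx, IsWeakFlow (H10 L) ν T w₀ G w wx ∧ w T = 0 :=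
  exists_isWeakFlow_eq_zero isClosed_H10 ((dense_span_sinMode hL).mono <| Submodule.span_mono <|
    range_subset_iff.2 (exists_hasDualDeriv_sinMode hL)) hν hT w₀

end Control

end

end LinNS

theorem mainTheorem2 (F : LinNS.Fluid) (L : ℝ) (hL : 0 < L)
    (ρ₀ u₀ θ₀ : LinNS.L2 L) (hρ₀ : ρ₀ ∈ LinNS.H1m L) (T : ℝ) (hT : 0 < T) :
    ∃ g h : ℝ → LinNS.L2 L, LinNS.MemL2L2 L T g ∧ LinNS.MemL2L2 L T h ∧
      ∃ ρ u θ : ℝ → LinNS.L2 L,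
        LinNS.IsSolution F L T ρ₀ u₀ θ₀ (fun _ => 0) g h ρ u θ ∧
        (∀ ρ' u' θ' : ℝ → LinNS.L2 L,
          LinNS.IsSolution F L T ρ₀ u₀ θ₀ (fun _ => 0) g h ρ' u' θ' →
            Set.EqOn ρ' ρ (Set.Icc 0 T) ∧ Set.EqOn u' u (Set.Icc 0 T) ∧
              Set.EqOn θ' θ (Set.Icc 0 T)) ∧
        ρ T = 0 ∧ u T = 0 ∧ θ T = 0 := by
  obtain ⟨⟨r₀, hr₀⟩, hmean⟩ := hρ₀
  obtain ⟨P, hP⟩ := LinNS.exists_mem_H10_of_integral_eq_zero hL hmean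
  obtain ⟨G, w, wx, hw, hwT⟩ := LinNS.exists_isWeakFlow_H10_eq_zero hL F.viscosity_pos hT u₀
  obtain ⟨Gu, u, ux, hu, huT, huxT⟩ := LinNS.exists_isWeakFlow_integral_eq LinNS.isClosed_H10
    F.viscosity_pos.ne' hT hw hwT ((LinNS.H10 L).smul_mem F.rhoBar⁻¹ hP)
    (hr₀.hasDualDeriv.const_smul F.rhoBar⁻¹)
  obtain ⟨Gθ, θ, θx, hθ, hθT⟩ := LinNS.exists_isWeakFlow_H10_eq_zero hL F.conductivity_pos hT θ₀
  obtain ⟨g, h, hg, hh, hsol⟩ :=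
    LinNS.exists_isSolution_of_isWeakFlow hT.le hr₀.hasDualDeriv hu hθ
  refine ⟨g, h, hg, hh, _, u, θ, hsol, fun ρ' u' θ' hsol' => hsol'.unique hT hsol, ?_, huT, hθT⟩
  rw [huxT, smul_inv_smul₀ F.rhoBar_pos.ne', sub_self]
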